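/- Theorem (algebraic-form Lamé equation, equianharmonic case). Let $g_2=0$, let $g_3\in\mathbb{C}$ be nonzero, and let $e_1,e_2,e_3$ be the (distinct) zeros of $4s^3-g_2s-g_3$, so that $4s^3-g_2s-g_3=4(s-e_1)(s-e_2)(s-e_3)$. Let $\ell,B\in\mathbb{C}$ with $\ell(\ell+1)\neq0$, and consider the algebraic-form Lamé equation with accessory parameter $B$, $$\frac{d^2\psi}{ds^2}+\left(\frac{1/2}{s-e_1}+\frac{1/2}{s-e_2}+\frac{1/2}{s-e_3}\right)\frac{d\psi}{ds}+\frac{[-\ell(\ell+1)/4]\,s-B/4}{(s-e_1)(s-e_2)(s-e_3)}\,\psi=0.$$ Say that a rational substitution $z=R(s)$, with $R\in\mathbb{C}(s)$, reduces this equation to the hypergeometric equation if, for some $a,b,c\in\mathbb{C}$, substituting $z=R(s)$, $\psi(s)=y(R(s))$ turns the hypergeometric equation $$\frac{d^2y}{dz^2}+\left(\frac{c}{z}+\frac{a+b-c+1}{z-1}\right)\frac{dy}{dz}+\frac{ab}{z(z-1)}\,y=0$$ into this Lamé equation; that is, for all but finitely many $s$ and every $y$ analytic near $R(s)$, the function $y\circ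 R$ satisfies the Lamé equation at $s$ if and only if $y$ satisfies the hypergeometric equation at $R(s)$. Then a rational substitution that reduces the Lamé equation to a hypergeometric equation exists if and only if $B=0$. If $B=0$, then every such $R$ is a cubic polynomial; moreover $z=4s^3/g_3$ and $z=1-4s^3/g_3$ both reduce the equation, and they are the only rational substitutions that do. -/

import Mathlib

/-- The function `y` satisfies the Gauss hypergeometric equation
`y'' + (c / z + (a + b - c + 1) / (z - 1)) y' + a b / (z (z - 1)) y = 0` at the point `z`. -/
def HypergeometricEqAt (a b c : ℂ) (y : ℂ → ℂ) (z : ℂ) : Prop :=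
  deriv (deriv y) z + (c / z + (a + b - c + 1) / (z - 1)) * deriv y z
    + a * b / (z * (z - 1)) * y z = 0

/-- The function `ψ` satisfies the algebraic-form Lamé equation with exponent parameter `ℓ`,
accessory parameter `B` and finite singular points `e₁, e₂, e₃` at the point `s`. -/
def LameEqAt (ℓ B e₁ e₂ e₃ : ℂ) (ψ : ℂ → ℂ) (s : ℂ) : Prop :=
  deriv (deriv ψ) s
    + ((1 / 2) / (s - e₁) + (1 / 2) / (s - e₂) + (1 / 2) / (s - e₃)) * deriv ψ s
    + (-(ℓ * (ℓ + 1) / 4) * s - B / 4) / ((s - e₁) * (s - e₂) * (s - e₃)) * ψ s = 0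

/-- The function on `ℂ` given by a rational function. (Its value at a pole is irrelevant below.) -/
noncomputable def ratFun (R : RatFunc ℂ) (s : ℂ) : ℂ :=
  R.eval (RingHom.id ℂ) s

/-- The rational substitution `z = R(s)` turns the hypergeometric equation with parameters
`a, b, c` into the Lamé equation: at all but finitely many points `s`, for every `y` analytic
near `R(s)`, the function `ψ = y ∘ R` satisfies the Lamé equation at `s` if and only if `y`
satisfies the hypergeometric equation at `R(s)`. As the 2-jet of `y` at `R(s)` is arbitrary, this
says that the pullback of the hypergeometric equation along `R` is the Lamé equation, as an
identity between the (rational) coefficients. -/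
def LameReducesBy (ℓ B e₁ e₂ e₃ : ℂ) (R : RatFunc ℂ) (a b c : ℂ) : Prop :=
  ∀ᶠ s in Filter.cofinite, ∀ y : ℂ → ℂ, AnalyticAt ℂ y (ratFun R s) →
    (LameEqAt ℓ B e₁ e₂ e₃ (fun t => y (ratFun R t)) s ↔
      HypergeometricEqAt a b c y (ratFun R s))

/-- `z = R(s)` reduces the Lamé equation to some hypergeometric equation. -/
def IsLameReduction (ℓ B e₁ e₂ e₃ : ℂ) (R : RatFunc ℂ) : Prop :=
  ∃ a b c : ℂ, LameReducesBy ℓ B e₁ e₂ e₃ R a b c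

open Polynomial

/-! Put `k = g₃ / 4`, `W = s³ - k`, `n = ℓ(ℓ+1)`, `β = B / n`. Since the 2-jet of `y` is arbitrary,
reduction amounts to two identities between coefficients (`pullback_iff_coefficients`). The one for
the coefficient of `ψ` reads `R'² W = κ (s + β) R (R - 1)` with `κ = -n / (4ab) ≠ 0`. A pole of `R`
would make `W` vanish doubly, whereas `W` has simple zeros; so `R` is a polynomial `f`
(`eval_denom_ne_zero_of_pullback`).

Differentiating this identity and eliminating `f''` with the other one gives `f (f - 1) = (s + β) f'
(E f + D)`. Hence `f(-β)` is 0 or 1, and the symmetry `f ↦ 1 - f` reduces to 0. Then `f = a (s +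
β)^m` (`eq_C_mul_pow_of_first_order`), and the quadratic identity leaves only `m = 3`, `β = 0`, `a =
1 / k` (`eq_three_of_pow_eq`). Thus `B = 0`; conversely, both cubics satisfy the two identities. -/

theorem Polynomial.eventually_eval_ne_zero {K : Type*} [Field K] {p : K[X]} (hp : p ≠ 0) :
    ∀ᶠ s in Filter.cofinite, p.eval s ≠ 0 := by
  rw [Filter.eventually_cofinite]
  simpa [not_not] using Polynomial.finite_setOfPred_isRoot hp

theorem Polynomial.eq_of_eventually_eval_eq {K : Type*} [Field K] [Infinite K] {p q : K[X]}
    (h : ∀ᶠ s in Filter.cofinite, p.eval s = q.eval s) : p = q :=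
  Polynomial.eq_of_infinite_eval_eq p q (Filter.frequently_cofinite_iff_infinite.1 h.frequently)

/-! ### Polynomial solutions of the coefficient identities -/

/-- A polynomial solution of the first-order equation that vanishes at `-β` is a multiple of a power
of `X + β`. -/
theorem eq_C_mul_pow_of_first_order {f : ℂ[X]} {β E D : ℂ} (hf : f ≠ 0) (h0 : f.eval (-β) = 0)
    (h : f * (f - 1) = (X + C β) * derivative f * (C E * f + C D)) :
    ∃ (m : ℕ) (a : ℂ), m ≠ 0 ∧ a ≠ 0 ∧ f = C a * (X + C β) ^ m := by
  obtain ⟨u, hfu, hu⟩ := Polynomial.exists_eq_pow_rootMultiplicity_mul_and_not_dvd f hf (-β)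
  have hm : 0 < f.rootMultiplicity (-β) := (Polynomial.rootMultiplicity_pos hf).2 h0
  obtain ⟨m, hm'⟩ : ∃ m, f.rootMultiplicity (-β) = m + 1 := ⟨_, (Nat.succ_pred_eq_of_pos hm).symm⟩
  rw [hm'] at hfu
  have hN : X - C (-β) = X + C β := by simp
  rw [hN] at hfu hu
  have hN0 : (X + C β : ℂ[X]) ≠ 0 := Polynomial.X_add_C_ne_zero β
  have hu' : u.eval (-β) ≠ 0 := by
    intro hh; apply hu; rw [← hN]; exact Polynomial.dvd_iff_isRoot.2 hh
  -- The equation after writing `f = (X + β)^(m+1) u` and cancelling `(X + β)^(m+1)`.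
  have key : u * (f - 1) = ((C ((m : ℂ) + 1)) * u + (X + C β) * derivative u) * (C E * f + C D) := by
    have hd : derivative f
        = (X + C β) ^ m * ((C ((m : ℂ) + 1)) * u + (X + C β) * derivative u) := by
      rw [hfu]; simp [derivative_pow]; ring
    have h2 : (X + C β) ^ (m + 1) * (u * (f - 1)) = (X + C β) ^ (m + 1) *
        (((C ((m : ℂ) + 1)) * u + (X + C β) * derivative u) * (C E * f + C D)) := by
      rw [hd] at h
      calc _ = ((X + C β) ^ (m + 1) * u) * (f - 1) := by ring
        _ = f * (f - 1) := by rw [← hfu]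
        _ = _ := by rw [h]; ring
    exact mul_left_cancel₀ (pow_ne_zero _ hN0) h2
  have hD : D ≠ 0 := by
    rintro rfl
    have := congrArg (Polynomial.eval (-β)) key
    simp [h0] at this
    exact hu' this
  -- Modulo `u` also `f ≡ 0`, so `key` reduces to `D (X + β) u' ≡ -(X + β) u' E f ≡ 0`; the factors
  -- `D` and `X + β` are invertible modulo `u`. By degree, `u` is then constant.
  have hdvd : u ∣ derivative u := by
    have hcop : IsCoprime u (X + C β) := by
      rw [← hN]
      refine ((Polynomial.irreducible_X_sub_C (-β)).coprime_iff_not_dvd.2 ?_).symm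
      rw [hN]; exact hu
    refine hcop.dvd_of_dvd_mul_left (?_ : u ∣ (X + C β) * derivative u)
    have : u ∣ C D * ((X + C β) * derivative u) := by
      refine ⟨(f - 1) - C ((m : ℂ) + 1) * (C E * f + C D)
        - (X + C β) * derivative u * C E * (X + C β) ^ (m + 1), ?_⟩
      linear_combination -key - ((X + C β) * derivative u * C E) * hfu
    rcases this with ⟨w, hw⟩
    refine ⟨C D⁻¹ * w, ?_⟩
    have hDD : (C D⁻¹ : ℂ[X]) * C D = 1 := by rw [← C_mul, inv_mul_cancel₀ hD, C_1]
    linear_combination C D⁻¹ * hw - (X + C β) * derivative u * hDD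
  have hu0 : u ≠ 0 := fun h => hu' (by simp [h])
  have hdu : derivative u = 0 := by
    by_contra hne
    have h1 := Polynomial.degree_le_of_dvd hdvd hne
    exact absurd (Polynomial.degree_derivative_lt hu0) (not_lt.2 h1)
  rw [Polynomial.derivative_eq_zero] at hdu
  obtain ⟨a, rfl⟩ := Polynomial.natDegree_eq_zero.1 hdu
  refine ⟨m + 1, a, by simp, ?_, ?_⟩
  · simpa using hu0
  · rw [hfu]; ring

theorem not_linear_pullback {β k κ a : ℂ} (hk : k ≠ 0) (ha : a ≠ 0)
    (h : C a * (X ^ 3 - C k) = C κ * (X + C β) ^ 2 * (C a * (X + C β) - 1)) : False := by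
  have ev : ∀ t : ℂ, a * ((t - β) ^ 3 - k) = κ * t ^ 2 * (a * t - 1) := fun t => by
    simpa using congrArg (Polynomial.eval (t - β)) h
  -- The coefficient of `t` is `3aβ²` on the left and 0 on the right; the weights extract it from
  -- the values at 1, -1, 2, 0.
  have hb : a * β ^ 2 = 0 := by
    linear_combination (1 / 3 : ℂ) * (ev 1 - (1 / 3 : ℂ) * ev (-1) - (1 / 6 : ℂ) * ev 2
      - (1 / 2 : ℂ) * ev 0)
  have hb0 : β = 0 := by simpa [ha] using hb
  simpa [hb0, ha, hk] using ev 0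

theorem not_quadratic_pullback {β k κ a : ℂ} (hk : k ≠ 0) (ha : a ≠ 0)
    (h : 4 * C a * (X ^ 3 - C k) = C κ * (X + C β) * (C a * (X + C β) ^ 2 - 1)) : False := by
  have ev : ∀ t : ℂ, 4 * a * ((t - β) ^ 3 - k) = κ * t * (a * t ^ 2 - 1) := fun t => by
    simpa using congrArg (Polynomial.eval (t - β)) h
  -- The coefficient of `t²`, obtained as a second difference: `-12aβ` against 0.
  have hb : a * β = 0 := by
    linear_combination (-1 / 24 : ℂ) * (ev 1 + ev (-1) - 2 * ev 0)
  have hb0 : β = 0 := by simpa [ha] using hb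
  simpa [hb0, ha, hk] using ev 0

/-- The case `m = j + 3` of the quadratic identity, after cancelling `a (X + β)^(j+4)`. If `j > 0`,
the left side vanishes at `-β` and the right side equals `-κ`. If `j = 0`, the coefficients in
powers of `X + β` give first `β = 0`, then `κ = 9`, then `a k = 1`. -/
theorem cubic_or_higher_pullback {β k κ a : ℂ} {j : ℕ} (hκ : κ ≠ 0) (ha : a ≠ 0)
    (h : C a * (C ((j : ℂ) + 3)) ^ 2 * (X + C β) ^ j * (X ^ 3 - C k)
        = C κ * (C a * (X + C β) ^ (j + 3) - 1)) : j = 0 ∧ β = 0 ∧ a = k⁻¹ := by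
  have ev : ∀ t : ℂ, a * (j + 3) ^ 2 * t ^ j * ((t - β) ^ 3 - k) = κ * (a * t ^ (j + 3) - 1) :=
    fun t => by simpa using congrArg (Polynomial.eval (t - β)) h
  have hj : j = 0 := by
    by_contra hj
    have := ev 0
    simp [hj, hκ] at this
  subst hj
  have e0 := ev 0
  have e1 := ev 1
  have e2 := ev (-1)
  simp only [Nat.cast_zero, pow_zero, zero_add] at e0 e1 e2
  have hb : a * β = 0 := by
    linear_combination (-1 / 54 : ℂ) * (e1 + e2 - 2 * e0)
  have hb0 : β = 0 := by simpa [ha] using hb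
  subst hb0
  have h9 : κ = 9 := by
    apply mul_left_cancel₀ ha
    linear_combination e0 - e1
  refine ⟨rfl, rfl, ?_⟩
  rw [h9] at e0
  apply eq_inv_of_mul_eq_one_left
  linear_combination (-1 / 9 : ℂ) * e0

/-- The only powers of a linear polynomial that solve the quadratic equation are the cubic ones. -/
theorem eq_three_of_pow_eq {β k κ a : ℂ} {m : ℕ} (hk : k ≠ 0) (hκ : κ ≠ 0) (ha : a ≠ 0)
    (hm : m ≠ 0)
    (h : derivative (C a * (X + C β) ^ m) ^ 2 * (X ^ 3 - C k)
      = C κ * (X + C β) * (C a * (X + C β) ^ m) * (C a * (X + C β) ^ m - 1)) :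
    m = 3 ∧ β = 0 ∧ a = k⁻¹ := by
  have hN0 : (X + C β : ℂ[X]) ≠ 0 := Polynomial.X_add_C_ne_zero β
  have ha' : (C a : ℂ[X]) ≠ 0 := by simpa
  obtain rfl | rfl | ⟨j, rfl⟩ : m = 1 ∨ m = 2 ∨ ∃ j, m = j + 3 := by
    rcases m with _ | _ | _ | j
    · exact absurd rfl hm
    · simp
    · simp
    · exact Or.inr (Or.inr ⟨j, rfl⟩)
  · refine (not_linear_pullback (β := β) (κ := κ) hk ha (mul_left_cancel₀ ha' ?_)).elim
    have hd : derivative (C a * (X + C β) ^ 1) = C a := by simp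
    rw [hd] at h
    linear_combination h
  · refine (not_quadratic_pullback (β := β) (κ := κ) hk ha
      (mul_left_cancel₀ (mul_ne_zero ha' (pow_ne_zero 2 hN0)) ?_)).elim
    have hd : derivative (C a * (X + C β) ^ 2) = C a * (2 * (X + C β)) := by
      simp [derivative_pow, map_ofNat]
    rw [hd] at h
    linear_combination h
  · have := cubic_or_higher_pullback (β := β) (k := k) (j := j) hκ ha
      (mul_left_cancel₀ (mul_ne_zero ha' (pow_ne_zero (j + 4) hN0)) (by
        have hd : derivative (C a * (X + C β) ^ (j + 3))
            = C a * C ((j : ℂ) + 3) * (X + C β) ^ (j + 2) := by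
          simp [derivative_pow]; ring
        rw [hd] at h
        linear_combination h))
    exact ⟨by omega, this.2⟩

/-- The polynomials that satisfy both coefficient identities and vanish at `-β`. -/
theorem polynomial_pullback_of_eval_eq_zero {f : ℂ[X]} {β k κ c d : ℂ} (hk : k ≠ 0) (hκ : κ ≠ 0)
    (hf : f ≠ 0) (h0 : f.eval (-β) = 0)
    (h2 : derivative f ^ 2 * (X ^ 3 - C k) = C κ * (X + C β) * f * (f - 1))
    (h1 : 2 * derivative (derivative f) * (X ^ 3 - C k) + 3 * X ^ 2 * derivative f
      = 2 * C κ * (X + C β) * (C d * f - C c)) :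
    β = 0 ∧ f = C k⁻¹ * X ^ 3 := by
  have hC : (C κ : ℂ[X]) ≠ 0 := by simpa
  have h3 : f * (f - 1) = (X + C β) * derivative f * (C (2 * d - 2) * f + C (1 - 2 * c)) := by
    apply mul_left_cancel₀ hC
    have hd := congrArg derivative h2
    simp only [derivative_mul, derivative_pow, derivative_sub, derivative_add, derivative_X,
      derivative_C, derivative_one, map_ofNat, Nat.cast_ofNat] at hd
    have e1 : (C (2 * d - 2) : ℂ[X]) = 2 * C d - 2 := by simp [map_ofNat]
    have e2 : (C (1 - 2 * c) : ℂ[X]) = 1 - 2 * C c := by simp [map_ofNat]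
    rw [e1, e2]
    -- Both `f' * h1` and the derivative of `h2` contain `2 f' f'' W + 3X² f'²`, which cancels.
    linear_combination derivative f * h1 - hd
  obtain ⟨m, a, hm, ha, rfl⟩ := eq_C_mul_pow_of_first_order hf h0 h3
  obtain ⟨rfl, rfl, rfl⟩ := eq_three_of_pow_eq hk hκ ha hm h2
  simp

/-- The first-order equation at `-β` forces `f(-β)` to be 0 or 1. Exchanging the singular points 0
and 1 of the hypergeometric equation, by `f ↦ 1 - f` and `c ↦ d - c` with `d = a + b + 1`, reduces
the second case to the first. -/
theorem polynomial_pullback {f : ℂ[X]} {β k κ c d : ℂ} (hk : k ≠ 0) (hκ : κ ≠ 0)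
    (hf : derivative f ≠ 0)
    (h2 : derivative f ^ 2 * (X ^ 3 - C k) = C κ * (X + C β) * f * (f - 1))
    (h1 : 2 * derivative (derivative f) * (X ^ 3 - C k) + 3 * X ^ 2 * derivative f
      = 2 * C κ * (X + C β) * (C d * f - C c)) :
    β = 0 ∧ (f = C k⁻¹ * X ^ 3 ∨ f = 1 - C k⁻¹ * X ^ 3) := by
  have hd := congrArg derivative h2
  simp only [derivative_mul, derivative_pow, derivative_sub, derivative_add, derivative_X,
      derivative_C, derivative_one, map_ofNat, Nat.cast_ofNat] at hd
  have h3 : C κ * f * (f - 1) = C κ * (X + C β) * derivative f *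
      ((2 * C d - 2) * f + 1 - 2 * C c) := by
    linear_combination derivative f * h1 - hd
  have h01 : f.eval (-β) = 0 ∨ f.eval (-β) = 1 := by
    have := congrArg (Polynomial.eval (-β)) h3
    simpa [hκ, sub_eq_zero] using this
  rcases h01 with h0 | h0
  · obtain ⟨hb, h⟩ := polynomial_pullback_of_eval_eq_zero hk hκ
      (by rintro rfl; simp at hf) h0 h2 h1
    exact ⟨hb, Or.inl h⟩
  · obtain ⟨hb, h⟩ := polynomial_pullback_of_eval_eq_zero (f := 1 - f) (c := d - c) (d := d)
      (β := β) hk hκ (fun h => hf (by rw [← sub_eq_zero.1 h]; simp)) (by simp [h0])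
      (by simp; linear_combination h2) (by simp; linear_combination -h1)
    exact ⟨hb, Or.inr (by rw [← h]; ring)⟩

/-! ### Absence of poles -/

/-- A rational function satisfying the quadratic identity has no poles. -/
theorem eval_denom_ne_zero_of_pullback {f g N : ℂ[X]} {k : ℂ} (hk : k ≠ 0) (hg : g ≠ 0) (hfg : IsCoprime f g)
    (h : (derivative f * g - f * derivative g) ^ 2 * (X ^ 3 - C k) = N * f * (f - g) * g ^ 2)
    (x : ℂ) : g.eval x ≠ 0 := by
  intro hx
  obtain ⟨u, hgu, hu⟩ := Polynomial.exists_eq_pow_rootMultiplicity_mul_and_not_dvd g hg x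
  have hm : 0 < g.rootMultiplicity x := (Polynomial.rootMultiplicity_pos hg).2 hx
  obtain ⟨m, hm'⟩ : ∃ m, g.rootMultiplicity x = m + 1 := ⟨_, (Nat.succ_pred_eq_of_pos hm).symm⟩
  rw [hm'] at hgu
  have hN0 : (X - C x : ℂ[X]) ≠ 0 := Polynomial.X_sub_C_ne_zero x
  have hu' : u.eval x ≠ 0 := fun hh => hu (Polynomial.dvd_iff_isRoot.2 hh)
  have hfx : f.eval x ≠ 0 := by
    intro hfx
    obtain ⟨p, q, hpq⟩ := hfg
    simpa [hfx, hx] using congrArg (Polynomial.eval x) hpq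
  -- With `g = (X - x)^(m+1) u`, the numerator of `(f/g)'` is `(X - x)^m v`, where `v(x) ≠ 0`.
  set v : ℂ[X] := (X - C x) * (derivative f * u - f * derivative u) - C ((m : ℂ) + 1) * f * u
    with hv
  have hvx : v.eval x ≠ 0 := by
    have : (m : ℂ) + 1 ≠ 0 := by exact_mod_cast Nat.succ_ne_zero m
    simp [hv, hu', hfx, this]
  have key : v ^ 2 * (X ^ 3 - C k) = (X - C x) ^ 2 * (N * f * (f - g) * u ^ 2) := by
    have hd : derivative f * g - f * derivative g = (X - C x) ^ m * v := by
      rw [hv, hgu]; simp [derivative_pow]; ring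
    rw [hd] at h
    apply mul_left_cancel₀ (pow_ne_zero (2 * m) hN0)
    calc _ = ((X - C x) ^ m * v) ^ 2 * (X ^ 3 - C k) := by ring
      _ = N * f * (f - g) * ((X - C x) ^ (m + 1) * u) ^ 2 := by rw [h, ← hgu]
      _ = _ := by ring
  -- By `key`, `(X - x)²` divides `v² (X³ - k)`, so `x` is a double zero of `X³ - k`; the derivative
  -- `3x²` then gives `x = 0`, contradicting `k ≠ 0`.
  have hW : x ^ 3 - k = 0 := by
    have := congrArg (Polynomial.eval x) key
    simpa [hvx] using this
  have hW' : x = 0 := by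
    have := congrArg (Polynomial.eval x) (congrArg derivative key)
    simpa [derivative_pow, hvx, hW] using this
  rw [hW'] at hW
  simp [hk] at hW

/-! ### Pulling back a second-order equation -/

theorem AnalyticAt.deriv_deriv_comp {y r : ℂ → ℂ} {s : ℂ} (hr : AnalyticAt ℂ r s)
    (hy : AnalyticAt ℂ y (r s)) :
    deriv (fun t => y (r t)) s = deriv y (r s) * deriv r s ∧
    deriv (deriv (fun t => y (r t))) s
      = deriv (deriv y) (r s) * deriv r s ^ 2 + deriv y (r s) * deriv (deriv r) s := by
  have h1 : ∀ᶠ t in nhds s, deriv (fun t => y (r t)) t = deriv y (r t) * deriv r t := by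
    filter_upwards [hr.eventually_analyticAt,
      hr.continuousAt.eventually hy.eventually_analyticAt] with t ht hyt
    exact deriv_comp t hyt.differentiableAt ht.differentiableAt
  refine ⟨h1.self_of_nhds, ?_⟩
  rw [Filter.EventuallyEq.deriv_eq h1]
  have h2 : HasDerivAt (fun t => deriv y (r t)) (deriv (deriv y) (r s) * deriv r s) s :=
    HasDerivAt.comp s hy.deriv.differentiableAt.hasDerivAt hr.differentiableAt.hasDerivAt
  rw [(h2.fun_mul hr.deriv.differentiableAt.hasDerivAt).deriv]
  ring

theorem exists_analyticAt_jet (z u v w : ℂ) : ∃ y : ℂ → ℂ, AnalyticAt ℂ y z ∧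
    y z = u ∧ deriv y z = v ∧ deriv (deriv y) z = w := by
  have hd : ∀ x : ℂ, HasDerivAt (fun x : ℂ => u + v * (x - z) + w / 2 * (x - z) ^ 2)
      (v + w * (x - z)) x := fun x => by
    have h := (hasDerivAt_id' x).sub_const z
    exact (((h.const_mul v).const_add u).add ((h.fun_pow 2).const_mul (w / 2))).congr_deriv
      (by push_cast; ring)
  have hdd : ∀ x : ℂ, HasDerivAt (fun x : ℂ => v + w * (x - z)) w x := fun x => by
    simpa using (((hasDerivAt_id' x).sub_const z).const_mul w).const_add v
  have hd' : deriv (fun x : ℂ => u + v * (x - z) + w / 2 * (x - z) ^ 2)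
      = fun x => v + w * (x - z) := funext fun x => (hd x).deriv
  refine ⟨fun x => u + v * (x - z) + w / 2 * (x - z) ^ 2, by fun_prop, by simp, ?_, ?_⟩
  · simp [hd']
  · rw [hd', (hdd z).deriv]

/-- A second-order equation pulls back to another along `r` at `s` exactly when the coefficients
satisfy the transformation rules. -/
theorem pullback_iff_coefficients {r : ℂ → ℂ} {s : ℂ} (hr : AnalyticAt ℂ r s) (p q P Q : ℂ) :
    (∀ y : ℂ → ℂ, AnalyticAt ℂ y (r s) →
      (deriv (deriv (fun t => y (r t))) s + P * deriv (fun t => y (r t)) s + Q * y (r s) = 0 ↔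
        deriv (deriv y) (r s) + p * deriv y (r s) + q * y (r s) = 0)) ↔
    deriv r s ≠ 0 ∧ deriv (deriv r) s + P * deriv r s = deriv r s ^ 2 * p ∧
      Q = deriv r s ^ 2 * q := by
  constructor
  · intro h
    have h' : ∀ u v w : ℂ, (w * deriv r s ^ 2 + v * deriv (deriv r) s + P * (v * deriv r s) + Q * u
        = 0 ↔ w + p * v + q * u = 0) := by
      intro u v w
      obtain ⟨y, hy, h0, h1, h2⟩ := exists_analyticAt_jet (r s) u v w
      have := h y hy
      rwa [(hr.deriv_deriv_comp hy).1, (hr.deriv_deriv_comp hy).2, h0, h1, h2] at this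
    -- Three jets `(y, y', y'')` suffice: `(0, 0, 1)` excludes `r' = 0`, while `(0, 1, -p)` and `(1,
    -- 0, -q)` solve the target equation and yield the two rules.
    refine ⟨fun h0 => ?_, ?_, ?_⟩
    · have := (h' 0 0 1).1 (by simp [h0])
      simp at this
    · linear_combination (h' 0 1 (-p)).2 (by ring)
    · linear_combination (h' 1 0 (-q)).2 (by ring)
  · rintro ⟨h0, h1, h2⟩ y hy
    rw [(hr.deriv_deriv_comp hy).1, (hr.deriv_deriv_comp hy).2]
    have : deriv (deriv y) (r s) * deriv r s ^ 2 + deriv y (r s) * deriv (deriv r) s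
        + P * (deriv y (r s) * deriv r s) + Q * y (r s)
        = deriv r s ^ 2 * (deriv (deriv y) (r s) + p * deriv y (r s) + q * y (r s)) := by
      linear_combination deriv y (r s) * h1 + y (r s) * h2
    rw [this]
    simp [h0]

theorem lameEqAt_iff {ℓ B e₁ e₂ e₃ k : ℂ} {ψ : ℂ → ℂ} {s : ℂ}
    (he : ∀ x : ℂ, x ^ 3 - k = (x - e₁) * (x - e₂) * (x - e₃)) (hs : s ^ 3 - k ≠ 0) :
    LameEqAt ℓ B e₁ e₂ e₃ ψ s ↔ deriv (deriv ψ) s + 3 * s ^ 2 / (2 * (s ^ 3 - k)) * deriv ψ s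
      + -(ℓ * (ℓ + 1) * s + B) / (4 * (s ^ 3 - k)) * ψ s = 0 := by
  have hP : (1 / 2) / (s - e₁) + (1 / 2) / (s - e₂) + (1 / 2) / (s - e₃)
      = 3 * s ^ 2 / (2 * (s ^ 3 - k)) := by
    -- The values of `he` at 1, -1, 0 encode that the first two elementary symmetric functions of
    -- the `eᵢ` vanish.
    have hsum : (s - e₂) * (s - e₃) + (s - e₁) * (s - e₃) + (s - e₁) * (s - e₂) = 3 * s ^ 2 := by
      linear_combination -s * (he 1 + he (-1) - 2 * he 0) - (1 / 2 : ℂ) * (he 1 - he (-1))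
    have hs' := hs
    rw [he] at hs'
    have h1 : s - e₁ ≠ 0 := fun h => hs' (by rw [h]; ring)
    have h2 : s - e₂ ≠ 0 := fun h => hs' (by rw [h]; ring)
    have h3 : s - e₃ ≠ 0 := fun h => hs' (by rw [h]; ring)
    rw [← hsum, he]
    field_simp
  have hQ : (-(ℓ * (ℓ + 1) / 4) * s - B / 4) / ((s - e₁) * (s - e₂) * (s - e₃))
      = -(ℓ * (ℓ + 1) * s + B) / (4 * (s ^ 3 - k)) := by
    rw [← he]; field_simp
    ring
  rw [LameEqAt, hP, hQ]

theorem ratFun_eq (R : RatFunc ℂ) (s : ℂ) : ratFun R s = R.num.eval s / R.denom.eval s := by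
  simp [ratFun, RatFunc.eval, Polynomial.eval₂_id]

theorem ratFun_algebraMap (f : ℂ[X]) : ratFun (algebraMap ℂ[X] (RatFunc ℂ) f) =
    fun s => f.eval s := by
  funext s
  simp [ratFun, Polynomial.eval₂_id]

theorem hasDerivAt_ratFun {R : RatFunc ℂ} {s : ℂ} (hs : R.denom.eval s ≠ 0) :
    HasDerivAt (ratFun R) ((R.num.derivative.eval s * R.denom.eval s
      - R.num.eval s * R.denom.derivative.eval s) / R.denom.eval s ^ 2) s := by
  have : ratFun R = fun s => R.num.eval s / R.denom.eval s := funext (ratFun_eq R)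
  rw [this]
  exact (R.num.hasDerivAt s).fun_div (R.denom.hasDerivAt s) hs

theorem Polynomial.analyticAt_eval (f : ℂ[X]) (s : ℂ) : AnalyticAt ℂ (fun s => f.eval s) s :=
  AnalyticOnNhd.eval_polynomial f s (Set.mem_univ s)

theorem analyticAt_ratFun {R : RatFunc ℂ} {s : ℂ} (hs : R.denom.eval s ≠ 0) :
    AnalyticAt ℂ (ratFun R) s := by
  have : ratFun R = fun s => R.num.eval s / R.denom.eval s := funext (ratFun_eq R)
  rw [this]
  exact (Polynomial.analyticAt_eval _ s).fun_div (Polynomial.analyticAt_eval _ s) hs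

theorem X_pow_three_sub_C_ne_zero (k : ℂ) : (X ^ 3 - C k : ℂ[X]) ≠ 0 :=
  Polynomial.X_pow_sub_C_ne_zero (by norm_num) k

/-! ### Necessary form of a reduction -/

/-- The reduction condition in terms of the coefficients of the two equations. -/
theorem lameReducesBy_iff {ℓ B e₁ e₂ e₃ k : ℂ} {R : RatFunc ℂ} {a b c : ℂ}
    (he : ∀ x : ℂ, x ^ 3 - k = (x - e₁) * (x - e₂) * (x - e₃)) :
    LameReducesBy ℓ B e₁ e₂ e₃ R a b c ↔ ∀ᶠ s in Filter.cofinite,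
      deriv (ratFun R) s ≠ 0 ∧
      deriv (deriv (ratFun R)) s + 3 * s ^ 2 / (2 * (s ^ 3 - k)) * deriv (ratFun R) s
        = deriv (ratFun R) s ^ 2 * (c / ratFun R s + (a + b - c + 1) / (ratFun R s - 1)) ∧
      -(ℓ * (ℓ + 1) * s + B) / (4 * (s ^ 3 - k))
        = deriv (ratFun R) s ^ 2 * (a * b / (ratFun R s * (ratFun R s - 1))) := by
  refine Filter.eventually_congr ?_
  filter_upwards [Polynomial.eventually_eval_ne_zero (X_pow_three_sub_C_ne_zero k),
    Polynomial.eventually_eval_ne_zero R.denom_ne_zero] with s hW hd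
  replace hW : s ^ 3 - k ≠ 0 := by simpa using hW
  rw [← pullback_iff_coefficients (analyticAt_ratFun hd)]
  simp only [lameEqAt_iff he hW, HypergeometricEqAt]

/-- A rational substitution that reduces the equation is a polynomial. -/
theorem exists_polynomial_of_lameReducesBy {ℓ B e₁ e₂ e₃ k : ℂ} {R : RatFunc ℂ} {a b c : ℂ}
    (hk : k ≠ 0) (he : ∀ x : ℂ, x ^ 3 - k = (x - e₁) * (x - e₂) * (x - e₃))
    (hℓ : ℓ * (ℓ + 1) ≠ 0) (h : LameReducesBy ℓ B e₁ e₂ e₃ R a b c) :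
    a * b ≠ 0 ∧ ∃ f : ℂ[X], R = algebraMap ℂ[X] (RatFunc ℂ) f := by
  have hN : (C (ℓ * (ℓ + 1)) * X + C B : ℂ[X]) ≠ 0 := fun h0 => hℓ (by
    simpa using congrArg (fun p : ℂ[X] => p.coeff 1) h0)
  rw [lameReducesBy_iff he] at h
  have hab : a * b ≠ 0 := by
    intro hab
    obtain ⟨s, ⟨⟨-, -, hs⟩, hW⟩, hNs⟩ := ((h.and (Polynomial.eventually_eval_ne_zero
      (X_pow_three_sub_C_ne_zero k))).and (Polynomial.eventually_eval_ne_zero hN)).exists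
    replace hW : s ^ 3 - k ≠ 0 := by simpa using hW
    rw [hab] at hs
    simp [hW] at hs
    apply hNs
    simp
    linear_combination -hs
  refine ⟨hab, ?_⟩
  have key : (derivative R.num * R.denom - R.num * derivative R.denom) ^ 2 * (X ^ 3 - C k)
      = (C (-1 / (4 * (a * b))) * (C (ℓ * (ℓ + 1)) * X + C B)) * R.num * (R.num - R.denom)
        * R.denom ^ 2 := by
    apply Polynomial.eq_of_eventually_eval_eq
    filter_upwards [h, Polynomial.eventually_eval_ne_zero (X_pow_three_sub_C_ne_zero k),
      Polynomial.eventually_eval_ne_zero R.denom_ne_zero,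
      Polynomial.eventually_eval_ne_zero hN] with s ⟨_, _, hs⟩ hW hd hNs
    replace hW : s ^ 3 - k ≠ 0 := by simpa using hW
    replace hNs : ℓ * (ℓ + 1) * s + B ≠ 0 := by simpa using hNs
    -- Division by zero yields 0, so a zero denominator here would make the coefficient of `ψ`
    -- vanish, against `hNs`.
    have hr : ratFun R s * (ratFun R s - 1) ≠ 0 := fun h0 => by
      rw [h0, div_zero, mul_zero, div_eq_zero_iff] at hs
      rcases hs with hs | hs
      · exact hNs (by linear_combination -hs)
      · simp [hW] at hs
    rw [(hasDerivAt_ratFun hd).deriv, ratFun_eq] at hs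
    rw [ratFun_eq] at hr
    have hf : R.num.eval s ≠ 0 := fun h0 => hr (by simp [h0])
    have hf1 : R.num.eval s - R.denom.eval s ≠ 0 := fun h0 => hr (by
      rw [sub_eq_zero.1 h0, div_self hd]; simp)
    simp only [eval_mul, eval_pow, eval_sub, eval_add, eval_X, eval_C]
    generalize R.num.derivative.eval s * R.denom.eval s
      - R.num.eval s * R.denom.derivative.eval s = D at hs ⊢
    generalize R.num.eval s = F at *
    generalize R.denom.eval s = G at *
    have e1 : F / G * (F / G - 1) = F * (F - G) / G ^ 2 := by field_simp
    have ha : a ≠ 0 := left_ne_zero_of_mul hab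
    have hb : b ≠ 0 := right_ne_zero_of_mul hab
    rw [e1] at hs
    field_simp at hs ⊢
    linear_combination -hs
  have hdeg : R.denom.degree = 0 := by
    by_contra hne
    obtain ⟨x, hx⟩ := Complex.exists_root (f := R.denom) (by
      rw [Polynomial.degree_eq_natDegree R.denom_ne_zero] at hne ⊢
      have : R.denom.natDegree ≠ 0 := by simpa using hne
      exact_mod_cast Nat.pos_of_ne_zero this)
    exact eval_denom_ne_zero_of_pullback hk R.denom_ne_zero R.isCoprime_num_denom key x hx
  refine ⟨R.num, ?_⟩
  have h1 : R.denom = 1 := by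
    rw [← R.monic_denom.degree_le_zero_iff_eq_one]; exact hdeg.le
  conv_lhs => rw [← R.num_div_denom, h1]
  simp

theorem lameReducesBy_classification {ℓ B e₁ e₂ e₃ k : ℂ} {R : RatFunc ℂ} {a b c : ℂ}
    (hk : k ≠ 0) (he : ∀ x : ℂ, x ^ 3 - k = (x - e₁) * (x - e₂) * (x - e₃))
    (hℓ : ℓ * (ℓ + 1) ≠ 0) (h : LameReducesBy ℓ B e₁ e₂ e₃ R a b c) :
    B = 0 ∧ (R = RatFunc.C k⁻¹ * RatFunc.X ^ 3 ∨ R = 1 - RatFunc.C k⁻¹ * RatFunc.X ^ 3) := by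
  obtain ⟨hab, f, rfl⟩ := exists_polynomial_of_lameReducesBy hk he hℓ h
  rw [lameReducesBy_iff he, ratFun_algebraMap] at h
  have hd1 : deriv (fun s => f.eval s) = fun s => f.derivative.eval s := funext fun s => f.deriv
  have hd2 : deriv (fun s => f.derivative.eval s) = fun s => f.derivative.derivative.eval s :=
    funext fun s => f.derivative.deriv
  simp only [hd1, hd2] at h
  have hf' : derivative f ≠ 0 := by
    rintro h0
    obtain ⟨s, hs, -⟩ := h.exists
    simp [h0] at hs
  have hf : f ≠ 0 := by rintro rfl; simp at hf'
  have hf1 : f - 1 ≠ 0 := fun h0 => by rw [sub_eq_zero.1 h0] at hf'; simp at hf'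
  set n := ℓ * (ℓ + 1) with hn
  set κ := -n / (4 * (a * b)) with hκ
  have hκ0 : κ ≠ 0 := div_ne_zero (neg_ne_zero.2 hℓ) (mul_ne_zero (by norm_num) hab)
  have h2 : derivative f ^ 2 * (X ^ 3 - C k) = C κ * (X + C (B / n)) * f * (f - 1) := by
    apply Polynomial.eq_of_eventually_eval_eq
    filter_upwards [h, Polynomial.eventually_eval_ne_zero (X_pow_three_sub_C_ne_zero k),
      Polynomial.eventually_eval_ne_zero hf,
      Polynomial.eventually_eval_ne_zero hf1] with s ⟨_, _, hs⟩ hW hf hf1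
    simp only [eval_mul, eval_pow, eval_sub, eval_add, eval_X, eval_C, eval_one] at hW hf1 ⊢
    have ha : a ≠ 0 := left_ne_zero_of_mul hab
    have hb : b ≠ 0 := right_ne_zero_of_mul hab
    rw [hκ]
    clear_value n
    field_simp at hs ⊢
    linear_combination -hs
  have h1 : 2 * derivative (derivative f) * (X ^ 3 - C k) + 3 * X ^ 2 * derivative f
      = 2 * C κ * (X + C (B / n)) * (C (a + b + 1) * f - C c) := by
    apply Polynomial.eq_of_eventually_eval_eq
    filter_upwards [h, Polynomial.eventually_eval_ne_zero (X_pow_three_sub_C_ne_zero k),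
      Polynomial.eventually_eval_ne_zero hf,
      Polynomial.eventually_eval_ne_zero hf1] with s ⟨_, hs, _⟩ hW hf hf1
    have h2s := congrArg (Polynomial.eval s) h2
    simp only [eval_mul, eval_pow, eval_sub, eval_add, eval_X, eval_C, eval_one, eval_ofNat]
      at hW hf1 h2s ⊢
    clear_value κ
    have e1 : c / f.eval s + (a + b - c + 1) / (f.eval s - 1)
        = ((a + b + 1) * f.eval s - c) / (f.eval s * (f.eval s - 1)) := by
      field_simp; ring
    rw [e1] at hs
    -- Replacing `f'²` through the quadratic identity cancels `f (f - 1)`, leaving an identity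
    -- linear in `f`, `f'`, `f''`.
    have e2 : f.derivative.eval s ^ 2 = κ * (s + B / n) * f.eval s * (f.eval s - 1)
        / (s ^ 3 - k) := by
      rw [← h2s]; field_simp
    rw [e2] at hs
    generalize B / n = β at *
    field_simp at hs
    linear_combination hs
  obtain ⟨hβ, hR⟩ := polynomial_pullback hk hκ0 hf' h2 h1
  refine ⟨by simpa [hℓ] using hβ, ?_⟩
  rcases hR with rfl | rfl
  · left; simp
  · right; simp

/-! ### The two cubic reductions -/

/-- The parameters come from the local exponents. The ordinary point `s = 0` has exponents 0, 1,
which become 0, 1/3 under the threefold map, so `c = 2/3`. At infinity the Lamé exponents `-ℓ/2`,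
`(ℓ+1)/2` are divided by 3. At `z = 1` the map is unramified, in accordance with `c - a - b = 1/2`.
-/
theorem lameReducesBy_cube {ℓ e₁ e₂ e₃ k : ℂ} (hk : k ≠ 0)
    (he : ∀ x : ℂ, x ^ 3 - k = (x - e₁) * (x - e₂) * (x - e₃)) :
    LameReducesBy ℓ 0 e₁ e₂ e₃ (RatFunc.C k⁻¹ * RatFunc.X ^ 3) (-ℓ / 6) ((ℓ + 1) / 6) (2 / 3) := by
  have hR : (RatFunc.C k⁻¹ * RatFunc.X ^ 3 : RatFunc ℂ)
      = algebraMap ℂ[X] (RatFunc ℂ) (C k⁻¹ * X ^ 3) := by simp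
  rw [hR, lameReducesBy_iff he, ratFun_algebraMap]
  have hd1 : deriv (fun s => (C k⁻¹ * X ^ 3 : ℂ[X]).eval s) = fun s => k⁻¹ * (3 * s ^ 2) :=
    funext fun s => by simp
  have hd2 : deriv (fun s : ℂ => k⁻¹ * (3 * s ^ 2)) = fun s => k⁻¹ * (6 * s) :=
    funext fun s => by simp; ring_nf; simp
  simp only [hd1, hd2]
  filter_upwards [Polynomial.eventually_eval_ne_zero (X_pow_three_sub_C_ne_zero k),
    Polynomial.eventually_eval_ne_zero (X_ne_zero (R := ℂ))] with s hW hs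
  simp only [eval_mul, eval_pow, eval_sub, eval_X, eval_C] at hW hs ⊢
  have e1 : k⁻¹ * s ^ 3 - 1 = (s ^ 3 - k) / k := by field_simp
  rw [e1]
  refine ⟨by simp [hk, hs], ?_, ?_⟩
  · field_simp
    ring
  · field_simp
    ring

/-- Exchanging 0 and 1 keeps `a`, `b` and replaces `c` by `a + b + 1 - c = 1/2`. -/
theorem lameReducesBy_one_sub_cube {ℓ e₁ e₂ e₃ k : ℂ} (hk : k ≠ 0)
    (he : ∀ x : ℂ, x ^ 3 - k = (x - e₁) * (x - e₂) * (x - e₃)) :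
    LameReducesBy ℓ 0 e₁ e₂ e₃ (1 - RatFunc.C k⁻¹ * RatFunc.X ^ 3)
      (-ℓ / 6) ((ℓ + 1) / 6) (1 / 2) := by
  have hR : (1 - RatFunc.C k⁻¹ * RatFunc.X ^ 3 : RatFunc ℂ)
      = algebraMap ℂ[X] (RatFunc ℂ) (1 - C k⁻¹ * X ^ 3) := by simp
  rw [hR, lameReducesBy_iff he, ratFun_algebraMap]
  have hd1 : deriv (fun s => (1 - C k⁻¹ * X ^ 3 : ℂ[X]).eval s) = fun s => -(k⁻¹ * (3 * s ^ 2)) :=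
    funext fun s => by simp
  have hd2 : deriv (fun s : ℂ => -(k⁻¹ * (3 * s ^ 2))) = fun s => -(k⁻¹ * (6 * s)) :=
    funext fun s => by simp; ring_nf; simp
  simp only [hd1, hd2]
  filter_upwards [Polynomial.eventually_eval_ne_zero (X_pow_three_sub_C_ne_zero k),
    Polynomial.eventually_eval_ne_zero (X_ne_zero (R := ℂ))] with s hW hs
  simp only [eval_mul, eval_pow, eval_sub, eval_X, eval_C, eval_one] at hW hs ⊢
  have e1 : 1 - k⁻¹ * s ^ 3 = -((s ^ 3 - k) / k) := by field_simp; ring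
  have e2 : -((s ^ 3 - k) / k) - 1 = -(s ^ 3 / k) := by field_simp; ring
  rw [e1, e2]
  refine ⟨by simp [hk, hs], ?_, ?_⟩
  · field_simp
    ring
  · field_simp
    ring

theorem mainTheorem9 (g₂ g₃ e₁ e₂ e₃ ℓ B : ℂ)
    (he : ∀ x : ℂ, 4 * x ^ 3 - g₂ * x - g₃ = 4 * (x - e₁) * (x - e₂) * (x - e₃))
    (hg₂ : g₂ = 0) (hg₃ : g₃ ≠ 0) (hℓ : ℓ * (ℓ + 1) ≠ 0) :
    ((∃ R : RatFunc ℂ, IsLameReduction ℓ B e₁ e₂ e₃ R) ↔ B = 0) ∧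
    (B = 0 →
      (∀ R : RatFunc ℂ, IsLameReduction ℓ B e₁ e₂ e₃ R →
        ∃ P : Polynomial ℂ, P.natDegree = 3 ∧ R = algebraMap (Polynomial ℂ) (RatFunc ℂ) P) ∧
      (∀ R : RatFunc ℂ, IsLameReduction ℓ B e₁ e₂ e₃ R ↔
        R = RatFunc.C (4 / g₃) * RatFunc.X ^ 3 ∨
        R = 1 - RatFunc.C (4 / g₃) * RatFunc.X ^ 3)) := by
  subst hg₂
  have hk : g₃ / 4 ≠ 0 := div_ne_zero hg₃ (by norm_num)
  have he' : ∀ x : ℂ, x ^ 3 - g₃ / 4 = (x - e₁) * (x - e₂) * (x - e₃) := fun x => by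
    linear_combination (1 / 4 : ℂ) * he x
  have hinv : (g₃ / 4)⁻¹ = 4 / g₃ := inv_div g₃ 4
  have hcube := lameReducesBy_cube (ℓ := ℓ) hk he'
  have hcube' := lameReducesBy_one_sub_cube (ℓ := ℓ) hk he'
  have hclass := fun (R : RatFunc ℂ) (h : IsLameReduction ℓ B e₁ e₂ e₃ R) =>
    let ⟨_, _, _, h'⟩ := h
    lameReducesBy_classification hk he' hℓ h'
  rw [hinv] at hcube hcube'
  simp only [hinv] at hclass
  refine ⟨⟨fun ⟨R, hR⟩ => (hclass R hR).1, ?_⟩, ?_⟩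
  · rintro rfl
    exact ⟨_, _, _, _, hcube⟩
  · rintro rfl
    have h4 : (4 / g₃ : ℂ) ≠ 0 := div_ne_zero (by norm_num) hg₃
    refine ⟨fun R hR => ?_, fun R => ⟨fun hR => (hclass R hR).2, ?_⟩⟩
    · rcases (hclass R hR).2 with rfl | rfl
      · exact ⟨C (4 / g₃) * X ^ 3, natDegree_C_mul_X_pow 3 _ h4, by simp⟩
      · refine ⟨1 - C (4 / g₃) * X ^ 3, ?_, by simp⟩
        rw [natDegree_sub_eq_right_of_natDegree_lt] <;> simp [natDegree_C_mul_X_pow 3 _ h4]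
    · rintro (rfl | rfl)
      · exact ⟨_, _, _, hcube⟩
      · exact ⟨_, _, _, hcube'⟩
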